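/- All simplicial complexes are finite. A simplicial complex $\Delta$ is a finite family of finite sets (its faces) closed under taking subsets; the empty face is counted, and the vertices of $\Delta$ are the elements of its faces. A facet is an inclusion-maximal face, and a $t$-face is a face of cardinality $t$. Write $\Delta_{(s)}$ for the set of faces of cardinality $s$, $f_s(\Delta)=|\Delta_{(s)}|$, and $\mathrm{lk}_\Delta\sigma=\{\tau\in\Delta : \tau\cap\sigma=\emptyset,\ \tau\cup\sigma\in\Delta\}$. Given a linear order on the vertices, $\Delta$ is shifted if for every face $\sigma$, every $v\in\sigma$ and every vertex $w<v$ of $\Delta$, the set $(\sigma\setminus\{v\})\cup\{w\}$ is a face. A family $\mathcal A$ of sets is $t$-intersecting if $|A\cap B|\ge t$ for all $A,B\in\mathcal A$. **Theorem 3.2.** Let $1\le t\le r$ be integers, let $\Delta$ be a shifted simplicial complex whose minimal facet cardinality $k$ satisfies $k\ge (t+1)(r-t+1)$, and let $S$ be a nonempty subset of $\{t,t+1,\dots,r\}$. Then every $t$-intersecting family $\mathcal A$ of faces of $\Delta$ with $\mathcal A\subseteq\bigcup_{s\in S}\Delta_{(s)}$ satisfies $$|\mathcal A|\le \max_{\sigma}\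 \sum_{s\in S} f_{s-t}(\mathrm{lk}_\Delta\sigma),$$ where the maximum is taken over all $t$-faces $\sigma$ of $\Delta$. -/

import Mathlib

/-- A finite abstract simplicial complex with vertices in `V`: a finite family of finite sets
(its faces) closed under taking subsets. As usual in combinatorics, the empty set is a face of
every complex that has a face at all, and it is counted among the faces. -/
@[ext]
structure FinComplex (V : Type*) where
  /-- The faces of the complex, the empty face included. -/
  faces : Finset (Finset V)
  /-- Every subset of a face is a face. -/
  down_closed : ∀ ⦃σ τ : Finset V⦄, σ ∈ faces → τ ⊆ σ → τ ∈ faces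

namespace FinComplex

/-- `v` is a vertex of `Δ`, that is, it lies in some face. -/
def IsVertex {V : Type*} (Δ : FinComplex V) (v : V) : Prop :=
  ∃ σ ∈ Δ.faces, v ∈ σ

/-- A facet is a face that is maximal with respect to inclusion. -/
def IsFacet {V : Type*} (Δ : FinComplex V) (σ : Finset V) : Prop :=
  Maximal (fun τ => τ ∈ Δ.faces) σ

/-- `k` is the minimal facet cardinality of `Δ` (so, in particular, `Δ` has a facet). -/
def IsMinFacetCard {V : Type*} (Δ : FinComplex V) (k : ℕ) : Prop :=
  IsLeast {m : ℕ | ∃ σ, Δ.IsFacet σ ∧ σ.card = m} k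

/-- `Δ.facesOfCard s` is the family of the faces of `Δ` of cardinality `s` (the `s`-faces). -/
def facesOfCard {V : Type*} (Δ : FinComplex V) (s : ℕ) : Finset (Finset V) :=
  Δ.faces.filter (fun σ => σ.card = s)

/-- `Δ.f s` is the number of faces of `Δ` of cardinality `s`. -/
def f {V : Type*} (Δ : FinComplex V) (s : ℕ) : ℕ :=
  (Δ.facesOfCard s).card

/-- The link of `σ` in `Δ`: all faces `τ` with `τ ∩ σ = ∅` and `τ ∪ σ` a face. -/
def link {V : Type*} [DecidableEq V] (Δ : FinComplex V) (σ : Finset V) : FinComplex V where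
  faces := Δ.faces.filter (fun τ => τ ∩ σ = ∅ ∧ τ ∪ σ ∈ Δ.faces)
  down_closed := by
    intro τ ρ hτ hρ
    rw [Finset.mem_filter] at hτ ⊢
    obtain ⟨h1, h2, h3⟩ := hτ
    refine ⟨Δ.down_closed h1 hρ, ?_, Δ.down_closed h3 (Finset.union_subset_union_left hρ)⟩
    exact Finset.subset_empty.mp (h2 ▸ Finset.inter_subset_inter_right hρ)

/-- `Δ` is shifted with respect to the linear order on its vertices: in any face, a vertex `i`
may be replaced by any smaller vertex `j` of `Δ`. -/
def IsShifted {V : Type*} [LinearOrder V] (Δ : FinComplex V) : Prop :=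
  ∀ σ ∈ Δ.faces, ∀ i ∈ σ, ∀ j : V, Δ.IsVertex j → j < i → σ \ {i} ∪ {j} ∈ Δ.faces

end FinComplex

/-- A family of sets is `t`-intersecting if any two of its members share at least `t` elements. -/
def IsTIntersecting {V : Type*} [DecidableEq V] (t : ℕ) (A : Finset (Finset V)) : Prop :=
  ∀ σ ∈ A, ∀ τ ∈ A, t ≤ (σ ∩ τ).card

/-!
The faces containing the set `σ₀` of the first `t` vertices form a largest `t`-intersecting family;
they correspond to the faces of the link of `σ₀` (`FinComplex.sum_f_link`).

By shifting (`exists_isShiftedOn`), which keeps a family inside a shifted complex and preserves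
cardinalities and `t`-intersection, the family may be taken to be shifted. If the complex is a full
simplex, the bound is the theorem of Frankl and Wilson for each cardinality
(`card_le_choose_of_isTIntersecting`). Otherwise let `m` be the last vertex
(`FinComplex.IsShifted.card_le`). The members avoiding `m` lie in the deletion of `m`, whose facets
are still of size at least `k`, since in a face through `m` that misses some vertex `j` one may
replace `m` by `j`. The members through `m`, with `m` removed, lie in the link of `m`, and they still
form a `t`-intersecting family: if `F` and `G` met in exactly `t` elements, `m` among them, replacing
`m` in `F` by a vertex outside `F ∪ G` would give a member meeting `G` in `t - 1` elements. Since the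
link has facets of size at least `k - 1` and the cardinalities are now at most `r - 1`, induction
applies to both parts.

The theorem of Frankl and Wilson in the full range `n ≥ (t + 1) * (k - t + 1)` is proved by the method
of generating sets of Ahlswede and Khachatryan, as an induction on the ground set
(`sum_extCount_le`). A family `G` of subsets of `X` stands for the `k`-sets of a fixed `n`-set whose
trace on `X` is in `G`. To remove the last point `m` of `X`, one needs to handle the members `E`
through `m` with `E \ {m}` not in the family. By shiftedness, two of these meet in only `t` points
only if they cover `X`, and then their sizes are complementary: they add up to `|X| + t`.
A selection (`exists_subfamily`) keeps enough of them, with `m` removed, to avoid all such pairs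
without losing weight. When no more than `t` points are left, only the trivial bound remains.
-/

/-! ### Shifting a family -/

/-- `A` is shifted with respect to the ordered ground set `X`: in a member of `A`, an element may be
replaced by any smaller element of `X` that is not yet there. In contrast to
`FinComplex.IsShifted`, the new element is required to be absent, so cardinalities are kept. -/
def IsShiftedOn {V : Type*} [LinearOrder V] (X : Finset V) (A : Finset (Finset V)) : Prop :=
  ∀ σ ∈ A, ∀ i ∈ σ, ∀ j ∈ X, j ∉ σ → j < i → insert j (σ.erase i) ∈ A

/-- The action on the member `σ` of the `(i, j)`-shift of the family `A`: replace `i` by `j` where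
this makes sense and does not produce a set already in `A`. -/
def shiftSet {V : Type*} [DecidableEq V] (A : Finset (Finset V)) (i j : V) (σ : Finset V) :
    Finset V :=
  if i ∈ σ ∧ j ∉ σ ∧ insert j (σ.erase i) ∉ A then insert j (σ.erase i) else σ

theorem card_insert_erase {V : Type*} [DecidableEq V] {i j : V} {σ : Finset V}
    (hi : i ∈ σ) (hj : j ∉ σ) : (insert j (σ.erase i)).card = σ.card := by
  rw [Finset.card_insert_of_notMem (fun h => hj (Finset.mem_of_mem_erase h)),
    Finset.card_erase_add_one hi]

theorem card_shiftSet {V : Type*} [DecidableEq V] (A : Finset (Finset V)) (i j : V)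
    (σ : Finset V) : (shiftSet A i j σ).card = σ.card := by
  unfold shiftSet
  split_ifs with h
  · exact card_insert_erase h.1 h.2.1
  · rfl

theorem insert_erase_insert_erase {V : Type*} [DecidableEq V] {i j : V} {σ : Finset V}
    (hi : i ∈ σ) (hj : j ∉ σ) : insert i ((insert j (σ.erase i)).erase j) = σ := by
  rw [Finset.erase_insert (fun h => hj (Finset.mem_of_mem_erase h)), Finset.insert_erase hi]

theorem shiftSet_injOn {V : Type*} [DecidableEq V] (A : Finset (Finset V)) (i j : V) :
    Set.InjOn (shiftSet A i j) A := by
  intro a ha b hb hab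
  simp only [shiftSet] at hab
  split_ifs at hab with h1 h2 h2
  · rw [← insert_erase_insert_erase h1.1 h1.2.1, hab, insert_erase_insert_erase h2.1 h2.2.1]
  · exact absurd (hab ▸ hb) h1.2.2
  · exact absurd (hab ▸ ha) h2.2.2
  · exact hab

theorem card_inter_insert_erase_left {V : Type*} [DecidableEq V] {i j : V} {a b : Finset V}
    (hj : j ∉ a) (h : i ∈ b → j ∈ b) :
    (a ∩ b).card ≤ (insert j (a.erase i) ∩ b).card := by
  by_cases hi : i ∈ a ∩ b
  · have hib := (Finset.mem_inter.mp hi).2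
    have : insert j ((a ∩ b).erase i) ⊆ insert j (a.erase i) ∩ b := by
      intro x hx
      have := h hib
      simp only [Finset.mem_insert, Finset.mem_erase, Finset.mem_inter] at hx ⊢
      rcases hx with rfl | hx
      · exact ⟨Or.inl rfl, this⟩
      · tauto
    rw [← card_insert_erase hi (fun h => hj (Finset.mem_inter.mp h).1)]
    exact Finset.card_le_card this
  · refine Finset.card_le_card fun x hx => ?_
    have : x ≠ i := fun h => hi (h ▸ hx)
    simp only [Finset.mem_insert, Finset.mem_erase, Finset.mem_inter] at hx ⊢
    tauto

theorem IsTIntersecting.shift {V : Type*} [DecidableEq V] {t : ℕ} {A : Finset (Finset V)}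
    (hA : IsTIntersecting t A) (i j : V) (hij : i ≠ j) :
    IsTIntersecting t (A.image (shiftSet A i j)) := by
  -- the case of one moved and one unmoved set
  have mixed : ∀ a ∈ A, ∀ b ∈ A, (i ∈ a ∧ j ∉ a ∧ insert j (a.erase i) ∉ A) →
      ¬ (i ∈ b ∧ j ∉ b ∧ insert j (b.erase i) ∉ A) → t ≤ (insert j (a.erase i) ∩ b).card := by
    intro a ha b hb h1 h2
    by_cases hb' : i ∈ b → j ∈ b
    · exact (hA a ha b hb).trans (card_inter_insert_erase_left h1.2.1 hb')
    · push Not at hb'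
      -- here the shift of `b` lies in `A`, so it meets `a` in at least `t` elements
      have h3 : insert j (b.erase i) ∈ A := by
        by_contra h
        exact h2 ⟨hb'.1, hb'.2, h⟩
      refine (hA a ha _ h3).trans (Finset.card_le_card fun x hx => ?_)
      simp only [Finset.mem_insert, Finset.mem_erase, Finset.mem_inter] at hx ⊢
      rcases hx with ⟨hxa, rfl | hx⟩
      · exact absurd hxa h1.2.1
      · tauto
  intro σ hσ τ hτ
  obtain ⟨a, ha, rfl⟩ := Finset.mem_image.mp hσ
  obtain ⟨b, hb, rfl⟩ := Finset.mem_image.mp hτ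
  simp only [shiftSet]
  split_ifs with h1 h2 h2
  · rw [← Finset.insert_inter_distrib]
    have h3 : a.erase i ∩ b.erase i = (a ∩ b).erase i := by
      ext x
      simp only [Finset.mem_erase, Finset.mem_inter]
      tauto
    rw [h3, card_insert_erase (Finset.mem_inter.mpr ⟨h1.1, h2.1⟩)
      (fun h => h1.2.1 (Finset.mem_inter.mp h).1)]
    exact hA a ha b hb
  · exact mixed a ha b hb h1 h2
  · rw [Finset.inter_comm]
    exact mixed b hb a ha h2 h1
  · exact hA a ha b hb

/-- A `t`-intersecting family inside a shifted family `U` can be replaced by a shifted one inside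
`U`, without changing the number of members of each cardinality (expressed by the weights `w`). -/
theorem exists_isShiftedOn {V : Type*} [LinearOrder V] {t : ℕ} {X : Finset V}
    {U : Finset (Finset V)} (hU : IsShiftedOn X U) (A : Finset (Finset V)) (hAU : A ⊆ U)
    (hA : IsTIntersecting t A) :
    ∃ B ⊆ U, IsTIntersecting t B ∧ IsShiftedOn X B ∧
      ∀ w : ℕ → ℕ, ∑ σ ∈ B, w σ.card = ∑ σ ∈ A, w σ.card := by
  -- each effective shift lowers the sum of the ranks of all elements of all members
  let rk : V → ℕ := fun v => (X.filter (· < v)).card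
  generalize hp : ∑ σ ∈ A, ∑ v ∈ σ, rk v = p
  induction p using Nat.strong_induction_on generalizing A with
  | _ p ih =>
  by_cases hs : IsShiftedOn X A
  · exact ⟨A, hAU, hA, hs, fun _ => rfl⟩
  unfold IsShiftedOn at hs
  push Not at hs
  obtain ⟨σ, hσ, i, hi, j, hjX, hj, hji, hne⟩ := hs
  have hrk : rk j < rk i := by
    refine Finset.card_lt_card (Finset.ssubset_iff_of_subset ?_ |>.mpr ⟨j, ?_, ?_⟩)
    · exact Finset.monotone_filter_right _ fun x _ hx => lt_trans hx hji
    · exact Finset.mem_filter.mpr ⟨hjX, hji⟩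
    · simp
  have hsum : ∀ τ : Finset V, i ∈ τ → j ∉ τ →
      ∑ v ∈ insert j (τ.erase i), rk v < ∑ v ∈ τ, rk v := by
    intro τ hiτ hjτ
    rw [Finset.sum_insert (fun h => hjτ (Finset.mem_of_mem_erase h)),
      ← Finset.add_sum_erase τ rk hiτ]
    omega
  have hinj := shiftSet_injOn A i j
  have hlt : ∑ σ ∈ A.image (shiftSet A i j), ∑ v ∈ σ, rk v < p := by
    rw [Finset.sum_image hinj, ← hp]
    refine Finset.sum_lt_sum (fun τ _ => ?_) ⟨σ, hσ, ?_⟩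
    · unfold shiftSet
      split_ifs with h
      · exact (hsum τ h.1 h.2.1).le
      · exact le_rfl
    · unfold shiftSet
      rw [if_pos ⟨hi, hj, hne⟩]
      exact hsum σ hi hj
  obtain ⟨B, hBU, hB, hBs, hBw⟩ := ih _ hlt (A.image (shiftSet A i j)) (by
    intro τ hτ
    obtain ⟨a, ha, rfl⟩ := Finset.mem_image.mp hτ
    unfold shiftSet
    split_ifs with h
    · exact hU a (hAU ha) i h.1 j hjX h.2.1 hji
    · exact hAU ha) (hA.shift i j hji.ne') rfl
  refine ⟨B, hBU, hB, hBs, fun w => ?_⟩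
  rw [hBw, Finset.sum_image hinj]
  simp only [card_shiftSet]

/-! ### The uniform case -/

/-- The number of ways to extend an `e`-set by elements of a disjoint `N`-set to a `k`-set; it is
zero if `k < e`. -/
def extCount (N k e : ℕ) : ℕ :=
  if e ≤ k then N.choose (k - e) else 0

theorem extCount_succ (N k e : ℕ) :
    extCount (N + 1) k e = extCount N k e + extCount N k (e + 1) := by
  unfold extCount
  rcases lt_trichotomy e k with h | rfl | h
  · obtain ⟨d, rfl⟩ := Nat.exists_eq_add_of_lt h
    rw [if_pos (by omega), if_pos (by omega), if_pos (by omega),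
      show e + d + 1 - e = d + 1 by omega, show e + d + 1 - (e + 1) = d by omega,
      Nat.choose_succ_succ, add_comm]
  · simp
  · rw [if_neg (by omega), if_neg (by omega), if_neg (by omega)]

theorem extCount_mul_le {N k i j : ℕ} (h : 2 * k ≤ N + i + j + 1) :
    extCount N k (i + 1) * extCount N k (j + 1) ≤ extCount N k i * extCount N k j := by
  unfold extCount
  by_cases hi : i + 1 ≤ k
  swap
  · simp [hi]
  by_cases hj : j + 1 ≤ k
  swap
  · simp [hj]
  rw [if_pos hi, if_pos hj, if_pos (by omega), if_pos (by omega)]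
  obtain ⟨a, rfl⟩ := Nat.exists_eq_add_of_le hi
  obtain ⟨b, hb⟩ := Nat.exists_eq_add_of_le hj
  rw [show i + 1 + a - (i + 1) = a by omega, show i + 1 + a - (j + 1) = b by omega,
    show i + 1 + a - i = a + 1 by omega, show i + 1 + a - j = b + 1 by omega]
  rcases lt_or_ge N a with ha | ha
  · simp [Nat.choose_eq_zero_of_lt ha]
  rcases lt_or_ge N b with hb' | hb'
  · simp [Nat.choose_eq_zero_of_lt hb']
  have h1 := Nat.choose_succ_right_eq N a
  have h2 := Nat.choose_succ_right_eq N b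
  have h3 : (a + 1) * (b + 1) ≤ (N - a) * (N - b) := by
    rw [mul_comm (N - a)]
    exact Nat.mul_le_mul (by omega) (by omega)
  refine Nat.le_of_mul_le_mul_left ?_ (show 0 < (a + 1) * (b + 1) by positivity)
  calc (a + 1) * (b + 1) * (N.choose a * N.choose b)
      ≤ (N - a) * (N - b) * (N.choose a * N.choose b) := Nat.mul_le_mul_right _ h3
    _ = (N.choose a * (N - a)) * (N.choose b * (N - b)) := by ring
    _ = (a + 1) * (b + 1) * (N.choose (a + 1) * N.choose (b + 1)) := by
        rw [← h1, ← h2]; ring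

/-- Of two families with `x` sets of size `i + 1` and `y` sets of size `j + 1`, at least one
compensates the loss of the other when a point is removed from all its members. -/
theorem extCount_pair {N k i j : ℕ} (h : 2 * k ≤ N + i + j + 1) (x y : ℕ) :
    y * extCount N k (j + 1) ≤ x * extCount N k i ∨
      x * extCount N k (i + 1) ≤ y * extCount N k j := by
  by_contra! hc
  have h1 := Nat.mul_lt_mul'' hc.1 hc.2
  have h2 := Nat.mul_le_mul_left (x * y) (extCount_mul_le h)
  have h3 : x * extCount N k i * (y * extCount N k j)
    = x * y * (extCount N k i * extCount N k j) := by ring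
  have h4 : y * extCount N k (j + 1) * (x * extCount N k (i + 1))
    = x * y * (extCount N k (i + 1) * extCount N k (j + 1)) := by ring
  omega

/-- The inequality behind the bound `n ≥ (t + 1) * (k - t + 1)`: it is applied to sets of size
`t + r` in a ground set of `t + 2 * r` points. -/
theorem extCount_diagonal {N k t r : ℕ} (ht : 1 ≤ t) (hr : 1 ≤ r)
    (hn : (t + 1) * (k - t + 1) ≤ N + (t + 2 * r)) :
    (t + 2 * r - 1) * extCount N k (t + r) ≤ r * extCount (N + 1) k (t + r - 1) := by
  unfold extCount
  by_cases hk : t + r ≤ k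
  swap
  · simp [hk]
  rw [if_pos hk, if_pos (by omega)]
  obtain ⟨a, rfl⟩ := Nat.exists_eq_add_of_le hk
  rw [show t + r + a - (t + r) = a by omega, show t + r + a - (t + r - 1) = a + 1 by omega]
  have h1 := Nat.add_one_mul_choose_eq N a
  rw [show t + r + a - t = r + a by omega] at hn
  have h2 : (t + 2 * r - 1) * (a + 1) ≤ r * (N + 1) := by
    obtain ⟨t, rfl⟩ := Nat.exists_eq_add_of_le' ht
    obtain ⟨r, rfl⟩ := Nat.exists_eq_add_of_le' hr
    rw [show t + 1 + 2 * (r + 1) - 1 = t + 2 * r + 2 by omega]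
    have := Nat.mul_le_mul_left (r + 1) hn
    nlinarith [Nat.zero_le (r * t), Nat.zero_le (r * t * (r + 1 + a + 1)), Nat.zero_le (r * t * a),
      Nat.zero_le (r * t * r)]
  refine Nat.le_of_mul_le_mul_left ?_ (show 0 < a + 1 by positivity)
  calc (a + 1) * ((t + 2 * r - 1) * N.choose a)
      = (t + 2 * r - 1) * (a + 1) * N.choose a := by ring
    _ ≤ r * (N + 1) * N.choose a := Nat.mul_le_mul_right _ h2
    _ = r * ((N + 1) * N.choose a) := by ring
    _ = (a + 1) * (r * (N + 1).choose (a + 1)) := by rw [h1]; ring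

/-- By averaging, some point other than `m` is missed by at least the average number of members of
a uniform family. -/
theorem exists_mul_card_le {V : Type*} [DecidableEq V] {X : Finset V} {m : V} (hm : m ∈ X)
    (hX : 2 ≤ X.card) {D : Finset (Finset V)} {i : ℕ}
    (hD : ∀ E ∈ D, E ⊆ X ∧ m ∈ E ∧ E.card = i) :
    ∃ l ∈ X.erase m, (X.card - i) * D.card ≤ (X.card - 1) * (D.filter (l ∉ ·)).card := by
  by_contra! hc
  have hcard : (X.erase m).card = X.card - 1 := Finset.card_erase_of_mem hm
  have hne : (X.erase m).Nonempty := Finset.card_pos.mp (by omega)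
  have h1 := Finset.sum_lt_sum_of_nonempty hne hc
  rw [← Finset.mul_sum, Finset.sum_const, hcard, smul_eq_mul] at h1
  have h2 : ∑ l ∈ X.erase m, (D.filter (l ∉ ·)).card = D.card * (X.card - i) := by
    refine (Finset.sum_card_bipartiteAbove_eq_sum_card_bipartiteBelow
      (s := X.erase m) (t := D) (fun l E => l ∉ E)).trans (Finset.sum_const_nat ?_)
    intro E hE
    obtain ⟨hEX, hmE, rfl⟩ := hD E hE
    rw [← Finset.card_sdiff_of_subset hEX]
    congr 1
    ext x
    simp only [Finset.mem_filter, Finset.mem_erase, Finset.mem_sdiff, Finset.bipartiteBelow]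
    constructor
    · tauto
    · rintro ⟨hx, hxE⟩
      exact ⟨⟨fun h => hxE (h ▸ hmE), hx⟩, hxE⟩
  rw [h2] at h1
  exact absurd h1 (by rw [mul_comm D.card]; exact lt_irrefl _)

/-- The selection for sets of the self-complementary size: those missing a suitable point `l` cannot
cover `X` in pairs, and there are enough of them by `exists_mul_card_le` and `extCount_diagonal`. -/
theorem exists_subfamily_diagonal {V : Type*} [DecidableEq V] {X : Finset V} {m : V} (hm : m ∈ X)
    {N k t : ℕ} (ht : 1 ≤ t) (htX : t < X.card) (hn : (t + 1) * (k - t + 1) ≤ N + X.card)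
    {D : Finset (Finset V)} (hD : ∀ E ∈ D, E ⊆ X ∧ m ∈ E ∧ 2 * E.card = X.card + t)
    (hconf : ∀ E ∈ D, ∀ F ∈ D, (E ∩ F).card ≤ t → E ∪ F = X) :
    ∃ U ⊆ D, (∀ E ∈ U, ∀ F ∈ U, t < (E ∩ F).card) ∧
      ∑ E ∈ D, extCount N k E.card ≤ ∑ E ∈ U, extCount (N + 1) k (E.card - 1) := by
  rcases D.eq_empty_or_nonempty with rfl | ⟨E₀, hE₀⟩
  · exact ⟨∅, by simp⟩
  obtain ⟨r, hr⟩ : ∃ r, X.card = t + 2 * r := ⟨E₀.card - t, by have := (hD E₀ hE₀).2.2; omega⟩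
  have hDc : ∀ E ∈ D, E.card = t + r := fun E hE => by have := (hD E hE).2.2; omega
  obtain ⟨l, hl, hle⟩ := exists_mul_card_le hm (by omega) (i := t + r)
    fun E hE => ⟨(hD E hE).1, (hD E hE).2.1, hDc E hE⟩
  refine ⟨D.filter (l ∉ ·), Finset.filter_subset _ _, ?_, ?_⟩
  · intro E hE F hF
    rw [Finset.mem_filter] at hE hF
    by_contra! hc
    have : l ∈ E ∪ F := hconf E hE.1 F hF.1 hc ▸ Finset.mem_of_mem_erase hl
    rcases Finset.mem_union.mp this with h | h
    · exact hE.2 h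
    · exact hF.2 h
  · rw [Finset.sum_congr rfl (fun E hE => by rw [hDc E hE]), Finset.sum_const,
      Finset.sum_congr rfl (fun E hE => by rw [hDc E (Finset.mem_filter.mp hE).1]),
      Finset.sum_const, smul_eq_mul, smul_eq_mul]
    have hw := extCount_diagonal (N := N) (k := k) ht (show 1 ≤ r by omega) (hr ▸ hn)
    rw [hr, show t + 2 * r - (t + r) = r by omega] at hle
    refine Nat.le_of_mul_le_mul_left ?_
      (Nat.mul_pos (show 0 < r by omega) (show 0 < t + 2 * r - 1 by omega))
    calc r * (t + 2 * r - 1) * (D.card * extCount N k (t + r))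
        = (r * D.card) * ((t + 2 * r - 1) * extCount N k (t + r)) := by ring
      _ ≤ ((t + 2 * r - 1) * (D.filter (l ∉ ·)).card) *
            (r * extCount (N + 1) k (t + r - 1)) := Nat.mul_le_mul hle hw
      _ = _ := by ring

/-- The selection step. In a family `B` of sets through `m` in which two members meet in at most `t`
points only if they have complementary sizes and cover `X`, there is a subfamily `H` with all
intersections larger than `t`, which loses no weight when `m` is removed from the ground set and from
its members. For each pair of distinct complementary sizes, all members of one of the two sizes are
kept; for the self-complementary size, those missing a suitable point. -/
theorem exists_subfamily {V : Type*} [DecidableEq V] {X : Finset V} {m : V} (hm : m ∈ X)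
    {N k t : ℕ} (ht : 1 ≤ t) (htX : t < X.card) (hn : (t + 1) * (k - t + 1) ≤ N + X.card)
    (hn' : 2 * k + 1 ≤ N + X.card + t)
    {B : Finset (Finset V)} (hB : ∀ E ∈ B, E ⊆ X ∧ m ∈ E ∧ t ≤ E.card)
    (hconf : ∀ E ∈ B, ∀ F ∈ B, (E ∩ F).card ≤ t →
      E ∪ F = X ∧ E.card + F.card = X.card + t) :
    ∃ H ⊆ B, (∀ E ∈ H, ∀ F ∈ H, t < (E ∩ F).card) ∧
      ∑ E ∈ B, extCount N k E.card ≤ ∑ E ∈ H, extCount (N + 1) k (E.card - 1) := by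
  classical
  obtain ⟨U, hUD, hU, hUw⟩ := exists_subfamily_diagonal hm ht htX hn
    (D := B.filter (fun E => 2 * E.card = X.card + t))
    (fun E hE => ⟨(hB E (Finset.mem_filter.mp hE).1).1, (hB E (Finset.mem_filter.mp hE).1).2.1,
      (Finset.mem_filter.mp hE).2⟩)
    (fun E hE F hF h => (hconf E (Finset.mem_filter.mp hE).1 F (Finset.mem_filter.mp hF).1 h).1)
  set s := X.card + t with hs
  let c : ℕ → ℕ := fun i => (B.filter (fun E => E.card = i)).card
  -- the sets of size `i` outweigh those of the complementary size `s - i`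
  let Q : ℕ → Prop := fun i =>
    c (s - i) * extCount N k (s - i) ≤ c i * extCount N k (i - 1)
  let P : ℕ → Prop := fun i => if 2 * i < s then Q i else ¬ Q (s - i)
  let H := B.filter (fun E => if 2 * E.card = s then E ∈ U else P E.card)
  have hHB : H ⊆ B := Finset.filter_subset _ _
  have hcardX : ∀ E ∈ B, E.card ∈ Finset.Icc t X.card := fun E hE =>
    Finset.mem_Icc.mpr ⟨(hB E hE).2.2, Finset.card_le_card (hB E hE).1⟩
  refine ⟨H, hHB, ?_, ?_⟩
  · intro E hE F hF
    by_contra! hc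
    obtain ⟨-, hEF⟩ := hconf E (hHB hE) F (hHB hF) hc
    have hE' := (Finset.mem_filter.mp hE).2
    have hF' := (Finset.mem_filter.mp hF).2
    by_cases h2 : 2 * E.card = s
    · rw [if_pos h2] at hE'
      rw [if_pos (by omega)] at hF'
      exact absurd (hU E hE' F hF') (by omega)
    · rw [if_neg h2] at hE'
      rw [if_neg (by omega)] at hF'
      simp only [P] at hE' hF'
      rcases lt_or_gt_of_ne h2 with h | h
      · rw [if_pos h] at hE'
        rw [if_neg (by omega), show s - F.card = E.card by omega] at hF'
        exact hF' hE'
      · rw [if_neg (by omega), show s - E.card = F.card by omega] at hE'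
        rw [if_pos (by omega)] at hF'
        exact hE' hF'
  -- compare the contributions of complementary sizes
  · let L : ℕ → ℕ := fun i => ∑ E ∈ B with E.card = i, extCount N k E.card
    let R : ℕ → ℕ := fun i => ∑ E ∈ H with E.card = i, extCount (N + 1) k (E.card - 1)
    have hL : ∑ E ∈ B, extCount N k E.card = ∑ i ∈ Finset.Icc t X.card, L i :=
      (Finset.sum_fiberwise_of_maps_to hcardX _).symm
    have hR : ∑ E ∈ H, extCount (N + 1) k (E.card - 1) = ∑ i ∈ Finset.Icc t X.card, R i :=
      (Finset.sum_fiberwise_of_maps_to (fun E hE => hcardX E (hHB hE)) _).symm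
    have refl : ∀ f : ℕ → ℕ,
        ∑ i ∈ Finset.Icc t X.card, f (s - i) = ∑ i ∈ Finset.Icc t X.card, f i := by
      intro f
      refine Finset.sum_nbij' (fun i => s - i) (fun i => s - i) ?_ ?_ ?_ ?_ ?_ <;>
        intro i hi <;> simp only [Finset.mem_Icc] at * <;> omega
    have hLc : ∀ i, L i = c i * extCount N k i := by
      intro i
      rw [show L i = ∑ E ∈ B with E.card = i, extCount N k i from
        Finset.sum_congr rfl fun E hE => by rw [(Finset.mem_filter.mp hE).2],
        Finset.sum_const, smul_eq_mul]
    have hRP : ∀ i, 1 ≤ i → 2 * i ≠ s → P i →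
        R i = c i * extCount N k (i - 1) + c i * extCount N k i := by
      intro i hi h2 hP
      have h1 : H.filter (fun E => E.card = i) = B.filter (fun E => E.card = i) := by
        rw [Finset.filter_filter]
        refine Finset.filter_congr fun E _ => ⟨And.right, fun h => ⟨?_, h⟩⟩
        rw [h, if_neg h2]
        exact hP
      have h3 : R i = ∑ E ∈ B with E.card = i, extCount (N + 1) k (i - 1) := by
        rw [← h1]
        exact Finset.sum_congr rfl fun E hE => by rw [(Finset.mem_filter.mp hE).2]
      rw [h3, Finset.sum_const, smul_eq_mul, extCount_succ, Nat.sub_add_cancel hi, mul_add]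
    have pair : ∀ i, t ≤ i → i ≤ X.card → 2 * i < s → L i + L (s - i) ≤ R i + R (s - i) := by
      intro i hi hiX h2
      rw [hLc, hLc]
      by_cases hQ : Q i
      · rw [hRP i (by omega) h2.ne (by simp only [P]; rwa [if_pos h2])]
        simp only [Q] at hQ
        omega
      · rw [hRP (s - i) (by omega) (by omega)
          (by simp only [P]; rwa [if_neg (by omega), show s - (s - i) = i by omega])]
        have := (extCount_pair (N := N) (k := k) (i := i - 1) (j := s - i - 1) (by omega) (c i)
          (c (s - i))).resolve_left (by
            rwa [show s - i - 1 + 1 = s - i by omega])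
        rw [show i - 1 + 1 = i by omega] at this
        omega
    have diag : ∀ i, 2 * i = s → L i ≤ R i := by
      intro i h2
      have h1 : B.filter (fun E => 2 * E.card = s) = B.filter (fun E => E.card = i) :=
        Finset.filter_congr fun E _ => by omega
      have h3 : H.filter (fun E => E.card = i) = U := by
        ext E
        simp only [H, Finset.mem_filter]
        constructor
        · rintro ⟨⟨-, h⟩, h4⟩
          rwa [if_pos (by omega)] at h
        · intro hE
          have h4 := Finset.mem_filter.mp (hUD hE)
          exact ⟨⟨h4.1, by rwa [if_pos h4.2]⟩, by omega⟩
      simp only [L, R]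
      rwa [h3, ← h1]
    have key : ∀ i ∈ Finset.Icc t X.card, L i + L (s - i) ≤ R i + R (s - i) := by
      intro i hi
      rw [Finset.mem_Icc] at hi
      rcases lt_trichotomy (2 * i) s with h | h | h
      · exact pair i hi.1 hi.2 h
      · rw [show s - i = i by omega]
        exact add_le_add (diag i h) (diag i h)
      · have := pair (s - i) (by omega) (by omega) (by omega)
        rw [show s - (s - i) = i by omega] at this
        omega
    have := Finset.sum_le_sum key
    rw [Finset.sum_add_distrib, Finset.sum_add_distrib, refl, refl] at this
    omega

/-- A weighted form of the theorem of Frankl and Wilson. For a ground set with `N` further points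
outside `X`, it bounds the number of `k`-sets whose trace on `X` lies in the `t`-intersecting
family `G`; the induction removes the last point of `X`. -/
theorem sum_extCount_le {V : Type*} [LinearOrder V] {n k t : ℕ} (ht : 1 ≤ t) (htk : t ≤ k)
    (hn : (t + 1) * (k - t + 1) ≤ n) (X : Finset V) (N : ℕ) (hN : N + X.card = n)
    (G : Finset (Finset V)) (hGX : G ⊆ X.powerset) (hG : IsTIntersecting t G) :
    ∑ E ∈ G, extCount N k E.card ≤ (n - t).choose (k - t) := by
  have hn' : 2 * k + 1 ≤ n + t := by
    obtain ⟨d, rfl⟩ := Nat.exists_eq_add_of_le htk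
    rw [show t + d - t = d by omega] at hn
    nlinarith [Nat.mul_le_mul_right d ht]
  induction hδ : X.card generalizing X N G with
  | zero =>
    have : G = ∅ := by
      refine Finset.eq_empty_of_forall_notMem fun E hE => ?_
      have h1 := hG E hE E hE
      have h2 := Finset.card_le_card (Finset.mem_powerset.mp (hGX hE))
      rw [Finset.inter_self] at h1
      omega
    simp [this]
  | succ δ ih =>
  have hbig : ∀ E ∈ G, t ≤ E.card := fun E hE => by
    have := hG E hE E hE
    rwa [Finset.inter_self] at this
  rcases le_or_gt X.card t with hXt | htX
  -- only the whole ground set, which then has exactly `t` points, can belong to the family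
  · have h1 : ∀ E ∈ G, E = X ∧ X.card = t := fun E hE => by
      have h2 := Finset.mem_powerset.mp (hGX hE)
      have h3 := Finset.card_le_card h2
      have h4 := hbig E hE
      exact ⟨Finset.eq_of_subset_of_card_le h2 (by omega), by omega⟩
    rcases G.eq_empty_or_nonempty with rfl | ⟨E₀, hE₀⟩
    · simp
    have hXt' := (h1 E₀ hE₀).2
    have h5 : G ⊆ {X} := fun E hE => Finset.mem_singleton.mpr (h1 E hE).1
    refine (Finset.sum_le_sum_of_subset h5).trans ?_
    rw [Finset.sum_singleton, hXt', extCount, if_pos htk, show N = n - t by omega]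
  have hne : X.Nonempty := Finset.card_pos.mp (by omega)
  set m := X.max' hne with hmdef
  have hm : m ∈ X := X.max'_mem hne
  have hmax : ∀ x ∈ X, x ≠ m → x < m := fun x hx h => lt_of_le_of_ne (X.le_max' x hx) h
  have hU : IsShiftedOn X X.powerset := by
    intro σ hσ i hi j hj _ _
    rw [Finset.mem_powerset] at hσ ⊢
    exact Finset.insert_subset hj ((Finset.erase_subset _ _).trans hσ)
  obtain ⟨A, hAX, hA, hAs, hAw⟩ := exists_isShiftedOn hU G hGX hG
  rw [← hAw]
  replace hbig : ∀ E ∈ A, t ≤ E.card := fun E hE => by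
    have := hA E hE E hE
    rwa [Finset.inter_self] at this
  let A₀ := A.filter (m ∉ ·)
  -- the members that are in the family only because of `m`
  let B := A.filter (fun E => m ∈ E ∧ E.erase m ∉ A)
  let C := A.filter (fun E => m ∈ E ∧ E.erase m ∈ A)
  obtain ⟨H, hHB, hH, hHw⟩ := exists_subfamily hm ht htX (N := N) (k := k) (by omega) (by omega)
    (B := B) (fun E hE => by
      have h := Finset.mem_filter.mp hE
      exact ⟨Finset.mem_powerset.mp (hAX h.1), h.2.1, hbig E h.1⟩)
    (by
      intro E hE F hF hEF
      have hE' := Finset.mem_filter.mp hE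
      have hF' := Finset.mem_filter.mp hF
      have hcov : E ∪ F = X := by
        refine subset_antisymm (Finset.union_subset (Finset.mem_powerset.mp (hAX hE'.1))
          (Finset.mem_powerset.mp (hAX hF'.1))) fun l hl => ?_
        by_contra hlEF
        rw [Finset.mem_union, not_or] at hlEF
        have h1 := hAs E hE'.1 m hE'.2.1 l hl hlEF.1
          (hmax l hl fun h => hlEF.1 (h ▸ hE'.2.1))
        have h2 := hA _ h1 F hF'.1
        rw [Finset.insert_inter_of_notMem hlEF.2, Finset.erase_inter,
          Finset.card_erase_of_mem (Finset.mem_inter.mpr ⟨hE'.2.1, hF'.2.1⟩)] at h2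
        omega
      refine ⟨hcov, ?_⟩
      have h1 := Finset.card_union_add_card_inter E F
      have h2 := hA E hE'.1 F hF'.1
      rw [hcov] at h1
      omega)
  have hHA : ∀ E ∈ H, E ∈ A ∧ m ∈ E ∧ E.erase m ∉ A := fun E hE =>
    Finset.mem_filter.mp (hHB hE)
  have hinj : ∀ S : Finset (Finset V), (∀ E ∈ S, m ∈ E) →
      Set.InjOn (fun E : Finset V => E.erase m) S := by
    intro S hS E hE F hF hEF
    rw [← Finset.insert_erase (hS E hE), ← Finset.insert_erase (hS F hF)]
    exact congrArg (insert m) hEF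
  -- the family of the next step
  have hdisj : Disjoint A₀ (H.image (fun E => E.erase m)) := by
    rw [Finset.disjoint_left]
    intro E hE hE'
    obtain ⟨F, hF, rfl⟩ := Finset.mem_image.mp hE'
    exact (hHA F hF).2.2 (Finset.mem_filter.mp hE).1
  have hXm : (X.erase m).card = X.card - 1 := Finset.card_erase_of_mem hm
  have hstep := ih (X.erase m) (N + 1) (by omega) (A₀ ∪ H.image (fun E => E.erase m)) (by
      intro E hE
      rw [Finset.mem_powerset]
      rcases Finset.mem_union.mp hE with h | h
      · have h' := Finset.mem_filter.mp h
        exact Finset.subset_erase.mpr ⟨Finset.mem_powerset.mp (hAX h'.1), h'.2⟩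
      · obtain ⟨F, hF, rfl⟩ := Finset.mem_image.mp h
        exact Finset.erase_subset_erase _ (Finset.mem_powerset.mp (hAX (hHA F hF).1)))
    (by
      have mixed : ∀ E ∈ A₀, ∀ F ∈ H, t ≤ (E ∩ F.erase m).card := by
        intro E hE F hF
        have h' := Finset.mem_filter.mp hE
        rw [Finset.inter_erase,
          Finset.erase_eq_of_notMem fun h => h'.2 (Finset.mem_inter.mp h).1]
        exact hA E h'.1 F (hHA F hF).1
      intro E hE F hF
      rcases Finset.mem_union.mp hE with h | h <;> rcases Finset.mem_union.mp hF with h' | h'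
      · exact hA E (Finset.mem_filter.mp h).1 F (Finset.mem_filter.mp h').1
      · obtain ⟨F₁, hF₁, rfl⟩ := Finset.mem_image.mp h'
        exact mixed E h F₁ hF₁
      · obtain ⟨E₁, hE₁, rfl⟩ := Finset.mem_image.mp h
        rw [Finset.inter_comm]
        exact mixed F h' E₁ hE₁
      · obtain ⟨F₁, hF₁, rfl⟩ := Finset.mem_image.mp h'
        obtain ⟨E₁, hE₁, rfl⟩ := Finset.mem_image.mp h
        have h1 := hH E₁ hE₁ F₁ hF₁
        rw [Finset.inter_erase, Finset.erase_inter, Finset.erase_idem]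
        have := Finset.pred_card_le_card_erase (s := E₁ ∩ F₁) (a := m)
        omega)
    (by omega)
  rw [Finset.sum_union hdisj, Finset.sum_image (hinj H fun E hE => (hHA E hE).2.1),
    Finset.sum_congr (s₁ := H) rfl
      (fun E hE => by rw [Finset.card_erase_of_mem (hHA E hE).2.1])] at hstep
  have hsplit : ∑ E ∈ A, extCount N k E.card = ∑ E ∈ A₀, extCount N k E.card +
      (∑ E ∈ C, extCount N k E.card + ∑ E ∈ B, extCount N k E.card) := by
    rw [← Finset.sum_filter_not_add_sum_filter A (m ∈ ·)]
    congr 1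
    rw [← Finset.sum_filter_add_sum_filter_not (A.filter (m ∈ ·)) (fun E => E.erase m ∈ A),
      Finset.filter_filter, Finset.filter_filter]
  have hC : ∑ E ∈ C, extCount N k E.card ≤ ∑ E ∈ A₀, extCount N k (E.card + 1) := by
    have hCm : ∀ E ∈ C, m ∈ E := fun E hE => (Finset.mem_filter.mp hE).2.1
    have h1 : ∑ E ∈ C.image (fun E => E.erase m), extCount N k (E.card + 1) =
        ∑ E ∈ C, extCount N k E.card := by
      rw [Finset.sum_image (hinj C hCm)]
      exact Finset.sum_congr rfl fun E hE => by rw [Finset.card_erase_add_one (hCm E hE)]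
    rw [← h1]
    refine Finset.sum_le_sum_of_subset fun E hE => ?_
    obtain ⟨F, hF, rfl⟩ := Finset.mem_image.mp hE
    exact Finset.mem_filter.mpr ⟨(Finset.mem_filter.mp hF).2.2, Finset.notMem_erase _ _⟩
  have hA₀ : ∑ E ∈ A₀, extCount (N + 1) k E.card =
      ∑ E ∈ A₀, extCount N k E.card + ∑ E ∈ A₀, extCount N k (E.card + 1) := by
    rw [← Finset.sum_add_distrib]
    exact Finset.sum_congr rfl fun E _ => extCount_succ N k E.card
  omega

/-- The theorem of Frankl and Wilson, in the range where fixing `t` points is optimal. -/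
theorem card_le_choose_of_isTIntersecting {V : Type*} [LinearOrder V] {k t : ℕ} (ht : 1 ≤ t)
    (htk : t ≤ k) (X : Finset V) (hX : (t + 1) * (k - t + 1) ≤ X.card) (G : Finset (Finset V))
    (hGX : G ⊆ X.powersetCard k) (hG : IsTIntersecting t G) :
    G.card ≤ (X.card - t).choose (k - t) := by
  have h := sum_extCount_le ht htk hX X 0 (zero_add _) G
    (fun E hE => Finset.mem_powerset.mpr (Finset.mem_powersetCard.mp (hGX hE)).1) hG
  rwa [Finset.sum_congr rfl (g := fun _ => 1) (fun E hE => by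
    rw [(Finset.mem_powersetCard.mp (hGX hE)).2]; simp [extCount]), Finset.sum_const,
    smul_eq_mul, mul_one] at h

/-! ### Shifted complexes -/

namespace FinComplex

variable {V : Type*}

/-- The set of vertices of `Δ`. -/
def vertexSet [DecidableEq V] (Δ : FinComplex V) : Finset V :=
  Δ.faces.biUnion id

theorem mem_vertexSet [DecidableEq V] {Δ : FinComplex V} {v : V} :
    v ∈ Δ.vertexSet ↔ Δ.IsVertex v := by
  simp [vertexSet, IsVertex]

theorem subset_vertexSet [DecidableEq V] {Δ : FinComplex V} {σ : Finset V} (hσ : σ ∈ Δ.faces) :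
    σ ⊆ Δ.vertexSet :=
  fun _ hv => mem_vertexSet.mpr ⟨σ, hσ, hv⟩

/-- The deletion of the vertex `m`: the faces that do not contain `m`. -/
def deletion [DecidableEq V] (Δ : FinComplex V) (m : V) : FinComplex V where
  faces := Δ.faces.filter (m ∉ ·)
  down_closed := by
    intro σ τ hσ hτ
    rw [Finset.mem_filter] at hσ ⊢
    exact ⟨Δ.down_closed hσ.1 hτ, fun h => hσ.2 (hτ h)⟩

theorem mem_deletion [DecidableEq V] {Δ : FinComplex V} {m : V} {σ : Finset V} :
    σ ∈ (Δ.deletion m).faces ↔ σ ∈ Δ.faces ∧ m ∉ σ :=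
  Finset.mem_filter

theorem mem_link_singleton [DecidableEq V] {Δ : FinComplex V} {m : V} {σ : Finset V} :
    σ ∈ (Δ.link {m}).faces ↔ m ∉ σ ∧ insert m σ ∈ Δ.faces := by
  simp only [link, Finset.mem_filter, Finset.union_singleton,
    ← Finset.disjoint_iff_inter_eq_empty, Finset.disjoint_singleton_right]
  exact ⟨And.right, fun h => ⟨Δ.down_closed h.2 (Finset.subset_insert _ _), h⟩⟩

theorem IsShifted.insert_erase_mem [LinearOrder V] {Δ : FinComplex V} (h : Δ.IsShifted)
    {σ : Finset V} (hσ : σ ∈ Δ.faces) {i j : V} (hi : i ∈ σ) (hj : Δ.IsVertex j) (hji : j < i) :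
    insert j (σ.erase i) ∈ Δ.faces := by
  have := h σ hσ i hi j hj hji
  rwa [Finset.sdiff_singleton_eq_erase, Finset.union_singleton] at this

theorem IsShifted.deletion [LinearOrder V] {Δ : FinComplex V} (h : Δ.IsShifted) (m : V) :
    (Δ.deletion m).IsShifted := by
  rintro σ hσ i hi j ⟨τ, hτ, hj⟩ hji
  rw [Finset.sdiff_singleton_eq_erase, Finset.union_singleton]
  rw [mem_deletion] at hσ hτ ⊢
  refine ⟨h.insert_erase_mem hσ.1 hi ⟨τ, hτ.1, hj⟩ hji, fun hm => ?_⟩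
  rcases Finset.mem_insert.mp hm with rfl | hm
  · exact hτ.2 hj
  · exact hσ.2 (Finset.mem_of_mem_erase hm)

theorem IsShifted.link_singleton [LinearOrder V] {Δ : FinComplex V} (h : Δ.IsShifted) (m : V) :
    (Δ.link {m}).IsShifted := by
  rintro σ hσ i hi j ⟨τ, hτ, hj⟩ hji
  rw [Finset.sdiff_singleton_eq_erase, Finset.union_singleton]
  rw [mem_link_singleton] at hσ hτ ⊢
  have hjm : m ≠ j := fun e => hτ.1 (e ▸ hj)
  have him : i ≠ m := fun e => hσ.1 (e ▸ hi)
  refine ⟨fun hm => ?_, ?_⟩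
  · rcases Finset.mem_insert.mp hm with e | hm
    · exact hjm e
    · exact hσ.1 (Finset.mem_of_mem_erase hm)
  · rw [Finset.insert_comm, ← Finset.erase_insert_of_ne him.symm]
    exact h.insert_erase_mem hσ.2 (Finset.mem_insert_of_mem hi)
      ⟨_, hτ.2, Finset.mem_insert_of_mem hj⟩ hji

/-- For a full simplex the bound holds separately for each cardinality. -/
theorem card_le_of_vertexSet_mem [LinearOrder V] {Δ : FinComplex V} {t r : ℕ} (ht : 1 ≤ t)
    (hX : Δ.vertexSet ∈ Δ.faces) (hk : (t + 1) * (r - t + 1) ≤ Δ.vertexSet.card)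
    {σ₀ : Finset V} (hσ₀ : σ₀.card = t) (hσ₀X : σ₀ ⊆ Δ.vertexSet)
    {S : Finset ℕ} (hS : ∀ s ∈ S, s ≤ r)
    {A : Finset (Finset V)} (hAS : A ⊆ Δ.faces.filter (fun F => F.card ∈ S))
    (hA : IsTIntersecting t A) :
    A.card ≤ (Δ.faces.filter (fun F => F.card ∈ S ∧ σ₀ ⊆ F)).card := by
  rw [Finset.card_eq_sum_card_fiberwise (f := Finset.card) (t := S)
      (fun F hF => (Finset.mem_filter.mp (hAS hF)).2),
    Finset.card_eq_sum_card_fiberwise (f := Finset.card) (t := S)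
      (s := Δ.faces.filter (fun F => F.card ∈ S ∧ σ₀ ⊆ F))
      (fun F hF => (Finset.mem_filter.mp hF).2.1)]
  refine Finset.sum_le_sum fun s hs => ?_
  rcases lt_or_ge s t with hst | hts
  · refine le_of_eq_of_le (Finset.card_eq_zero.mpr ?_) (Nat.zero_le _)
    refine Finset.filter_eq_empty_iff.mpr fun F hF hFs => ?_
    have := hA F hF F hF
    rw [Finset.inter_self] at this
    omega
  have h1 : (A.filter (fun F => F.card = s)).card ≤ (Δ.vertexSet.card - t).choose (s - t) := by
    refine card_le_choose_of_isTIntersecting ht hts Δ.vertexSet ?_ _ ?_ ?_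
    · refine le_trans (Nat.mul_le_mul_left _ ?_) hk
      have := hS s hs
      omega
    · intro F hF
      rw [Finset.mem_filter] at hF
      exact Finset.mem_powersetCard.mpr
        ⟨subset_vertexSet (Finset.mem_filter.mp (hAS hF.1)).1, hF.2⟩
    · exact fun F hF G hG => hA F (Finset.mem_filter.mp hF).1 G (Finset.mem_filter.mp hG).1
  refine h1.trans ?_
  rw [← hσ₀, ← Finset.card_sdiff_of_subset hσ₀X, ← Finset.card_powersetCard]
  refine Finset.card_le_card_of_injOn (· ∪ σ₀) ?_ ?_
  · intro F hF
    rw [Finset.mem_coe, Finset.mem_powersetCard] at hF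
    have hd : Disjoint F σ₀ := Finset.disjoint_of_subset_left hF.1 Finset.sdiff_disjoint
    have hc : (F ∪ σ₀).card = s := by
      rw [Finset.card_union_of_disjoint hd, hF.2]
      omega
    simp only [Finset.coe_filter, Finset.mem_filter, Set.mem_ofPred_eq]
    exact ⟨⟨Δ.down_closed hX (Finset.union_subset (hF.1.trans Finset.sdiff_subset) hσ₀X),
      hc.symm ▸ hs, Finset.subset_union_right⟩, hc⟩
  · intro F hF G hG hFG
    rw [Finset.mem_coe, Finset.mem_powersetCard] at hF hG
    have hF' : Disjoint F σ₀ := Finset.disjoint_of_subset_left hF.1 Finset.sdiff_disjoint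
    have hG' : Disjoint G σ₀ := Finset.disjoint_of_subset_left hG.1 Finset.sdiff_disjoint
    rw [← Finset.union_sdiff_cancel_right hF', ← Finset.union_sdiff_cancel_right hG']
    exact congrArg (· \ σ₀) hFG

/-- Members of a shifted `t`-intersecting family through a common last vertex `m` still meet in `t`
elements after the removal of `m`, provided that there are enough vertices. -/
theorem le_card_erase_inter_erase [LinearOrder V] {X : Finset V} {A : Finset (Finset V)}
    {t r : ℕ} (hA : IsTIntersecting t A) (hAs : IsShiftedOn X A)
    (hX : 2 * r < X.card + t) {m : V} (hmax : ∀ x ∈ X, x ≠ m → x < m) {F G : Finset V}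
    (hF : F ∈ A) (hG : G ∈ A) (hmF : m ∈ F) (hmG : m ∈ G) (hFr : F.card ≤ r) (hGr : G.card ≤ r) :
    t ≤ (F.erase m ∩ G.erase m).card := by
  by_contra! hc
  have hm : m ∈ F ∩ G := Finset.mem_inter.mpr ⟨hmF, hmG⟩
  rw [Finset.inter_erase, Finset.erase_inter, Finset.erase_idem,
    Finset.card_erase_of_mem hm] at hc
  have h1 := hA F hF G hG
  have h2 := Finset.card_union_add_card_inter F G
  obtain ⟨j, hjX, hj⟩ : ∃ j ∈ X, j ∉ F ∪ G :=
    Finset.exists_mem_notMem_of_card_lt_card (by omega)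
  rw [Finset.mem_union, not_or] at hj
  have h3 := hA _ (hAs F hF m hmF j hjX hj.1 (hmax j hjX fun h => hj.1 (h ▸ hmF))) G hG
  rw [Finset.insert_inter_of_notMem hj.2, Finset.erase_inter, Finset.card_erase_of_mem hm] at h3
  omega

/-- In a shifted complex all of whose facets have at least `k ≥ (t + 1) * (r - t + 1)` elements, the
faces containing the first `t` vertices `σ₀` form a largest `t`-intersecting family among the faces
of cardinality in `S`. If the complex is not a full simplex, it is split by its last vertex `m` into
the deletion, which keeps the bound `k`, and the link, where `r` and `k` both drop by one. -/
theorem IsShifted.card_le [LinearOrder V] {t : ℕ} (ht : 1 ≤ t) {σ₀ : Finset V}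
    (hσ₀ : σ₀.card = t) (Δ : FinComplex V) (hΔ : Δ.IsShifted) (r k : ℕ) (htr : t ≤ r)
    (hk : (t + 1) * (r - t + 1) ≤ k)
    (hext : ∀ σ ∈ Δ.faces, ∃ τ ∈ Δ.faces, σ ⊆ τ ∧ k ≤ τ.card)
    (hσ₀X : σ₀ ⊆ Δ.vertexSet) (hfirst : ∀ v ∈ Δ.vertexSet, v ∉ σ₀ → ∀ u ∈ σ₀, u < v)
    (S : Finset ℕ) (hS : ∀ s ∈ S, s ≤ r)
    (A : Finset (Finset V)) (hAS : A ⊆ Δ.faces.filter (fun F => F.card ∈ S))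
    (hA : IsTIntersecting t A) :
    A.card ≤ (Δ.faces.filter (fun F => F.card ∈ S ∧ σ₀ ⊆ F)).card := by
  induction hp : Δ.faces.card using Nat.strong_induction_on generalizing Δ r k S A with
  | _ p ih =>
  have hkt : t + 1 ≤ k := le_trans (Nat.le_mul_of_pos_right _ (Nat.succ_pos _)) hk
  obtain ⟨u₀, hu₀⟩ : σ₀.Nonempty := Finset.card_pos.mp (by omega)
  obtain ⟨ρ, hρ, -⟩ := mem_vertexSet.mp (hσ₀X hu₀)
  obtain ⟨ρ', hρ', -, hkρ⟩ := hext ρ hρ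
  have hkX : k ≤ Δ.vertexSet.card := hkρ.trans (Finset.card_le_card (subset_vertexSet hρ'))
  by_cases hsimplex : Δ.vertexSet ∈ Δ.faces
  · exact card_le_of_vertexSet_mem ht hsimplex (hk.trans hkX) hσ₀ hσ₀X hS hAS hA
  have hne : Δ.vertexSet.Nonempty := ⟨u₀, hσ₀X hu₀⟩
  set m := Δ.vertexSet.max' hne with hmdef
  have hm : m ∈ Δ.vertexSet := Finset.max'_mem _ _
  have hmax : ∀ x ∈ Δ.vertexSet, x ≠ m → x < m :=
    fun x hx h => lt_of_le_of_ne (Finset.le_max' _ x hx) h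
  have hmσ₀ : m ∉ σ₀ := by
    intro h
    obtain ⟨v, hv, hv'⟩ : ∃ v ∈ Δ.vertexSet, v ∉ σ₀ :=
      Finset.exists_mem_notMem_of_card_lt_card (by omega)
    exact absurd (hfirst v hv hv' m h) (Finset.le_max' _ v hv).not_gt
  have hU : IsShiftedOn Δ.vertexSet (Δ.faces.filter (fun F => F.card ∈ S)) := by
    intro σ hσ i hi j hj hjσ hji
    rw [Finset.mem_filter] at hσ ⊢
    rw [card_insert_erase hi hjσ]
    exact ⟨hΔ.insert_erase_mem hσ.1 hi (mem_vertexSet.mp hj) hji, hσ.2⟩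
  obtain ⟨B, hBS, hB, hBs, hBw⟩ := exists_isShiftedOn hU A hAS hA
  have hBA : B.card = A.card := by simpa using hBw fun _ => 1
  rw [← hBA]
  obtain ⟨ν, hν, hmν⟩ := mem_vertexSet.mp hm
  have hdel_lt : (Δ.deletion m).faces.card < p := by
    rw [← hp]
    refine Finset.card_lt_card (Finset.ssubset_iff_of_subset (Finset.filter_subset _ _) |>.mpr
      ⟨ν, hν, fun h => (mem_deletion.mp h).2 hmν⟩)
  have hlink_sub : (Δ.link {m}).faces ⊆ (Δ.deletion m).faces := fun σ hσ => by
    rw [mem_link_singleton] at hσ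
    exact mem_deletion.mpr ⟨Δ.down_closed hσ.2 (Finset.subset_insert _ _), hσ.1⟩
  have hlink_lt : (Δ.link {m}).faces.card < p :=
    (Finset.card_le_card hlink_sub).trans_lt hdel_lt
  have hdelX : (Δ.deletion m).vertexSet ⊆ Δ.vertexSet := fun v hv => by
    obtain ⟨σ, hσ, hvσ⟩ := mem_vertexSet.mp hv
    exact mem_vertexSet.mpr ⟨σ, (mem_deletion.mp hσ).1, hvσ⟩
  have hlinkX : (Δ.link {m}).vertexSet ⊆ Δ.vertexSet := fun v hv => by
    obtain ⟨σ, hσ, hvσ⟩ := mem_vertexSet.mp hv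
    exact mem_vertexSet.mpr ⟨σ, (mem_deletion.mp (hlink_sub hσ)).1, hvσ⟩
  -- members of the family avoiding `m`
  have hdel : (B.filter (m ∉ ·)).card ≤
      ((Δ.deletion m).faces.filter (fun F => F.card ∈ S ∧ σ₀ ⊆ F)).card := by
    refine ih _ hdel_lt (Δ.deletion m) (hΔ.deletion m) r k htr hk ?_ ?_
      (fun v hv => hfirst v (hdelX hv)) S hS _ ?_
      (fun F hF G hG => hB F (Finset.mem_filter.mp hF).1 G (Finset.mem_filter.mp hG).1) rfl
    -- in a face through `m` that is not the whole vertex set, `m` can be replaced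
    · intro σ hσ
      rw [mem_deletion] at hσ
      obtain ⟨τ, hτ, hστ, hkτ⟩ := hext σ hσ.1
      by_cases hmτ : m ∈ τ
      · obtain ⟨j, hj, hjτ⟩ : ∃ j ∈ Δ.vertexSet, j ∉ τ := by
          by_contra! h
          exact hsimplex (Δ.down_closed hτ h)
        have hjm : m ≠ j := fun h => hjτ (h ▸ hmτ)
        refine ⟨insert j (τ.erase m), mem_deletion.mpr
          ⟨hΔ.insert_erase_mem hτ hmτ (mem_vertexSet.mp hj) (hmax j hj hjm.symm), ?_⟩, ?_, ?_⟩
        · simp [hjm]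
        · exact (Finset.subset_erase.mpr ⟨hστ, hσ.2⟩).trans (Finset.subset_insert _ _)
        · rwa [card_insert_erase hmτ hjτ]
      · exact ⟨τ, mem_deletion.mpr ⟨hτ, hmτ⟩, hστ, hkτ⟩
    · intro u hu
      obtain ⟨σ, hσ, huσ⟩ := mem_vertexSet.mp (hσ₀X hu)
      refine mem_vertexSet.mpr ⟨{u}, mem_deletion.mpr
        ⟨Δ.down_closed hσ (Finset.singleton_subset_iff.mpr huσ), ?_⟩, Finset.mem_singleton_self u⟩
      exact fun h => hmσ₀ (Finset.mem_singleton.mp h ▸ hu)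
    · intro F hF
      rw [Finset.mem_filter] at hF
      have := Finset.mem_filter.mp (hBS hF.1)
      exact Finset.mem_filter.mpr ⟨mem_deletion.mpr ⟨this.1, hF.2⟩, this.2⟩
  -- members of the family through `m`
  have hBr : ∀ F ∈ B, F.card ≤ r := fun F hF => hS _ (Finset.mem_filter.mp (hBS hF)).2
  have h2r : 2 * r < Δ.vertexSet.card + t := by
    obtain ⟨d, rfl⟩ := Nat.exists_eq_add_of_le htr
    rw [show t + d - t = d by omega] at hk
    nlinarith [Nat.mul_le_mul_right d ht]
  let Bm := (B.filter (m ∈ ·)).image (fun F => F.erase m)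
  have hBm : Bm.card = (B.filter (m ∈ ·)).card := by
    refine Finset.card_image_of_injOn fun F hF G hG hFG => ?_
    rw [Finset.mem_coe, Finset.mem_filter] at hF hG
    rw [← Finset.insert_erase hF.2, ← Finset.insert_erase hG.2]
    exact congrArg (insert m) hFG
  have hBmt : IsTIntersecting t Bm := by
    intro F' hF' G' hG'
    obtain ⟨F, hF, rfl⟩ := Finset.mem_image.mp hF'
    obtain ⟨G, hG, rfl⟩ := Finset.mem_image.mp hG'
    rw [Finset.mem_filter] at hF hG
    exact le_card_erase_inter_erase hB hBs h2r hmax hF.1 hG.1 hF.2 hG.2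
      (hBr F hF.1) (hBr G hG.1)
  have hlink : Bm.card ≤ (Δ.faces.filter
      (fun F => (F.card ∈ S ∧ σ₀ ⊆ F) ∧ m ∈ F)).card := by
    rcases htr.eq_or_lt with rfl | htr'
    -- the sets in `Bm` are now too small to be `t`-intersecting
    · have : Bm = ∅ := by
        refine Finset.eq_empty_of_forall_notMem fun F' hF' => ?_
        have h1 := hBmt F' hF' F' hF'
        obtain ⟨F, hF, rfl⟩ := Finset.mem_image.mp hF'
        rw [Finset.mem_filter] at hF
        have h2 := hBr F hF.1
        rw [Finset.inter_self, Finset.card_erase_of_mem hF.2] at h1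
        omega
      simp [this]
    have hextl : ∀ σ ∈ (Δ.link {m}).faces, ∃ τ ∈ (Δ.link {m}).faces, σ ⊆ τ ∧ k - 1 ≤ τ.card := by
      intro σ hσ
      rw [mem_link_singleton] at hσ
      obtain ⟨τ, hτ, hστ, hkτ⟩ := hext _ hσ.2
      have hmτ : m ∈ τ := hστ (Finset.mem_insert_self _ _)
      refine ⟨τ.erase m, mem_link_singleton.mpr
        ⟨Finset.notMem_erase _ _, by rwa [Finset.insert_erase hmτ]⟩, ?_, ?_⟩
      · exact Finset.subset_erase.mpr ⟨(Finset.subset_insert _ _).trans hστ, hσ.1⟩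
      · rw [Finset.card_erase_of_mem hmτ]
        omega
    let S' := (Finset.range r).filter (fun s => s + 1 ∈ S)
    have hS' : ∀ s, s ∈ S' ↔ s + 1 ∈ S := fun s => by
      simp only [S', Finset.mem_filter, Finset.mem_range]
      exact ⟨And.right, fun h => ⟨hS _ h, h⟩⟩
    have h1 := ih _ hlink_lt (Δ.link {m}) (hΔ.link_singleton m) (r - 1) (k - 1) (by omega) (by
        obtain ⟨d, rfl⟩ := Nat.exists_eq_add_of_lt htr'
        rw [show t + d + 1 - t = d + 1 by omega] at hk
        rw [show t + d + 1 - 1 - t = d by omega]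
        have : (t + 1) * (d + 1 + 1) = (t + 1) * (d + 1) + (t + 1) := by ring
        omega) hextl (by
        -- in a large face of the link, an element outside `σ₀` can be replaced by `u ∈ σ₀`
        intro u hu
        obtain ⟨τ, hτ, -, hkτ⟩ := hextl ∅ (mem_link_singleton.mpr
          ⟨Finset.notMem_empty m, Δ.down_closed hν (by simpa using hmν)⟩)
        by_cases huτ : u ∈ τ
        · exact subset_vertexSet hτ huτ
        obtain ⟨v, hvτ, hv⟩ : ∃ v ∈ τ, v ∉ σ₀.erase u := by
          refine Finset.exists_mem_notMem_of_card_lt_card ?_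
          rw [Finset.card_erase_of_mem hu]
          omega
        have hvσ₀ : v ∉ σ₀ := fun h =>
          hv (Finset.mem_erase.mpr ⟨fun e => huτ (e ▸ hvτ), h⟩)
        rw [mem_link_singleton] at hτ
        have hvm : m ≠ v := fun e => hτ.1 (e ▸ hvτ)
        have hvX := subset_vertexSet hτ.2 (Finset.mem_insert_of_mem hvτ)
        have h2 := hΔ.insert_erase_mem hτ.2 (Finset.mem_insert_of_mem hvτ)
          (mem_vertexSet.mp (hσ₀X hu)) (hfirst v hvX hvσ₀ u hu)
        refine mem_vertexSet.mpr ⟨{u}, mem_link_singleton.mpr ⟨?_, Δ.down_closed h2 ?_⟩,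
          Finset.mem_singleton_self u⟩
        · exact fun h => hmσ₀ (Finset.mem_singleton.mp h ▸ hu)
        · intro x hx
          rcases Finset.mem_insert.mp hx with rfl | hx
          · exact Finset.mem_insert_of_mem
              (Finset.mem_erase.mpr ⟨hvm, Finset.mem_insert_self _ _⟩)
          · exact Finset.mem_singleton.mp hx ▸ Finset.mem_insert_self _ _)
      (fun v hv => hfirst v (hlinkX hv)) S' (fun s hs => by
        have := hS _ ((hS' s).mp hs)
        omega) Bm (by
        intro F' hF'
        obtain ⟨F, hF, rfl⟩ := Finset.mem_image.mp hF'
        rw [Finset.mem_filter] at hF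
        have h2 := Finset.mem_filter.mp (hBS hF.1)
        rw [Finset.mem_filter, hS', Finset.card_erase_add_one hF.2, mem_link_singleton,
          Finset.insert_erase hF.2]
        exact ⟨⟨Finset.notMem_erase _ _, h2.1⟩, h2.2⟩) hBmt rfl
    refine h1.trans (Finset.card_le_card_of_injOn (insert m) ?_ ?_)
    · intro F hF
      rw [Finset.mem_coe, Finset.mem_filter, mem_link_singleton, hS'] at hF
      rw [Finset.mem_coe, Finset.mem_filter, Finset.card_insert_of_notMem hF.1.1]
      exact ⟨hF.1.2, ⟨hF.2.1, hF.2.2.trans (Finset.subset_insert _ _)⟩,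
        Finset.mem_insert_self _ _⟩
    · intro F hF G hG hFG
      rw [Finset.mem_coe, Finset.mem_filter, mem_link_singleton] at hF hG
      rw [← Finset.erase_insert hF.1.1, ← Finset.erase_insert hG.1.1, hFG]
  have hsplit : (Δ.faces.filter (fun F => F.card ∈ S ∧ σ₀ ⊆ F)).card =
      (Δ.faces.filter (fun F => (F.card ∈ S ∧ σ₀ ⊆ F) ∧ m ∈ F)).card +
      ((Δ.deletion m).faces.filter (fun F => F.card ∈ S ∧ σ₀ ⊆ F)).card := by
    rw [← Finset.card_filter_add_card_filter_not (m ∈ ·), Finset.filter_filter,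
      Finset.filter_filter]
    congr 2
    ext F
    simp only [Finset.mem_filter, mem_deletion]
    tauto
  rw [hsplit, ← Finset.card_filter_add_card_filter_not (s := B) (m ∈ ·), ← hBm]
  exact add_le_add hlink hdel

theorem exists_subset_face [LinearOrder V] {Δ : FinComplex V} {k : ℕ} (hk : Δ.IsMinFacetCard k)
    {σ : Finset V} (hσ : σ ∈ Δ.faces) : ∃ τ ∈ Δ.faces, σ ⊆ τ ∧ k ≤ τ.card := by
  obtain ⟨τ, hστ, hτ⟩ := Δ.faces.exists_le_maximal hσ
  exact ⟨τ, hτ.prop, hστ, hk.2 ⟨τ, hτ, rfl⟩⟩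

/-- Adding `σ` turns the faces of the link into the faces of `Δ` containing `σ`. -/
theorem sum_f_link [DecidableEq V] (Δ : FinComplex V) (σ : Finset V) {S : Finset ℕ}
    (hS : ∀ s ∈ S, σ.card ≤ s) :
    ∑ s ∈ S, (Δ.link σ).f (s - σ.card) =
      (Δ.faces.filter (fun F => F.card ∈ S ∧ σ ⊆ F)).card := by
  rw [Finset.card_eq_sum_card_fiberwise (f := Finset.card) (t := S)
      (s := Δ.faces.filter (fun F => F.card ∈ S ∧ σ ⊆ F))
      (fun F hF => (Finset.mem_filter.mp hF).2.1)]
  refine Finset.sum_congr rfl fun s hs => ?_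
  have hle := hS s hs
  refine Finset.card_nbij' (· ∪ σ) (· \ σ) ?_ ?_ ?_ ?_
  · intro τ hτ
    simp only [facesOfCard, link, Finset.coe_filter, Finset.mem_filter, Set.mem_ofPred_eq] at hτ ⊢
    have hc : (τ ∪ σ).card = s := by
      rw [Finset.card_union_of_disjoint (Finset.disjoint_iff_inter_eq_empty.mpr hτ.1.2.1)]
      omega
    exact ⟨⟨hτ.1.2.2, hc.symm ▸ hs, Finset.subset_union_right⟩, hc⟩
  · intro F hF
    simp only [facesOfCard, link, Finset.coe_filter, Finset.mem_filter, Set.mem_ofPred_eq] at hF ⊢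
    refine ⟨⟨Δ.down_closed hF.1.1 Finset.sdiff_subset, Finset.sdiff_inter_self _ _, ?_⟩, ?_⟩
    · rw [Finset.sdiff_union_of_subset hF.1.2.2]
      exact hF.1.1
    · rw [Finset.card_sdiff_of_subset hF.1.2.2, hF.2]
  · intro τ hτ
    simp only [facesOfCard, link, Finset.coe_filter, Finset.mem_filter, Set.mem_ofPred_eq] at hτ
    exact Finset.union_sdiff_cancel_right (Finset.disjoint_iff_inter_eq_empty.mpr hτ.1.2.1)
  · intro F hF
    simp only [Finset.coe_filter, Finset.mem_filter, Set.mem_ofPred_eq] at hF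
    exact Finset.sdiff_union_of_subset hF.1.2.2

end FinComplex

theorem Finset.exists_initial_subset {V : Type*} [LinearOrder V] (X : Finset V) {t : ℕ}
    (h : t ≤ X.card) : ∃ σ ⊆ X, σ.card = t ∧ ∀ v ∈ X, v ∉ σ → ∀ u ∈ σ, u < v := by
  induction X using Finset.induction_on_max with
  | empty => exact ⟨∅, by simp at h ⊢; omega⟩
  | insert a X ha ih =>
    have haX : a ∉ X := fun h => lt_irrefl _ (ha a h)
    rw [Finset.card_insert_of_notMem haX] at h
    rcases h.eq_or_lt with rfl | h
    · exact ⟨insert a X, subset_rfl, Finset.card_insert_of_notMem haX,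
        fun v hv hv' => absurd hv hv'⟩
    · obtain ⟨σ, hσX, hσ, hfirst⟩ := ih (by omega)
      refine ⟨σ, hσX.trans (Finset.subset_insert _ _), hσ, fun v hv hvσ u hu => ?_⟩
      rcases Finset.mem_insert.mp hv with rfl | hv
      · exact ha u (hσX hu)
      · exact hfirst v hv hvσ u hu

theorem theorem3p2 {V : Type*} [LinearOrder V] (Δ : FinComplex V) (hΔ : Δ.IsShifted)
    (t r k : ℕ) (ht : 1 ≤ t) (htr : t ≤ r)
    (hk : Δ.IsMinFacetCard k) (hkr : (t + 1) * (r - t + 1) ≤ k)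
    (S : Finset ℕ) (hS : S.Nonempty) (hSr : S ⊆ Finset.Icc t r) :
    ∃ M : ℕ,
      IsGreatest {m : ℕ | ∃ σ ∈ Δ.facesOfCard t, m = ∑ s ∈ S, (Δ.link σ).f (s - t)} M ∧
      ∀ A : Finset (Finset V), A ⊆ S.biUnion Δ.facesOfCard → IsTIntersecting t A →
        A.card ≤ M := by
  have hkt : t + 1 ≤ k := le_trans (Nat.le_mul_of_pos_right _ (Nat.succ_pos _)) hkr
  obtain ⟨ρ, hρ, hρk⟩ := hk.1
  have hρΔ : ρ ∈ Δ.faces := hρ.prop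
  obtain ⟨σ₁, hσ₁ρ, hσ₁⟩ := Finset.exists_subset_card_eq (s := ρ) (n := t) (by omega)
  have hne : (Δ.facesOfCard t).Nonempty :=
    ⟨σ₁, Finset.mem_filter.mpr ⟨Δ.down_closed hρΔ hσ₁ρ, hσ₁⟩⟩
  obtain ⟨σ, hσ, hmax⟩ :=
    (Δ.facesOfCard t).exists_max_image (fun σ => ∑ s ∈ S, (Δ.link σ).f (s - t)) hne
  refine ⟨_, ⟨⟨σ, hσ, rfl⟩, ?_⟩, fun A hAS hA => ?_⟩
  · rintro _ ⟨τ, hτ, rfl⟩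
    exact hmax τ hτ
  have hρX := Finset.card_le_card (FinComplex.subset_vertexSet hρΔ)
  obtain ⟨σ₀, hσ₀X, hσ₀, hfirst⟩ := Δ.vertexSet.exists_initial_subset (t := t) (by omega)
  have hle := FinComplex.IsShifted.card_le ht hσ₀ Δ hΔ r k htr hkr
    (fun _ => FinComplex.exists_subset_face hk) hσ₀X hfirst S
    (fun s hs => (Finset.mem_Icc.mp (hSr hs)).2) A (by
      intro F hF
      obtain ⟨s, hs, hFs⟩ := Finset.mem_biUnion.mp (hAS hF)
      obtain ⟨hFΔ, rfl⟩ := Finset.mem_filter.mp hFs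
      exact Finset.mem_filter.mpr ⟨hFΔ, hs⟩) hA
  refine hle.trans ?_
  by_cases hσ₀Δ : σ₀ ∈ Δ.faces
  · rw [← Δ.sum_f_link σ₀ fun s hs => hσ₀ ▸ (Finset.mem_Icc.mp (hSr hs)).1, hσ₀]
    exact hmax σ₀ (Finset.mem_filter.mpr ⟨hσ₀Δ, hσ₀⟩)
  -- were `σ₀` not a face, no face would contain it
  · rw [Finset.card_eq_zero.mpr (Finset.filter_eq_empty_iff.mpr
      fun F hF h => hσ₀Δ (Δ.down_closed hF h.2))]
    exact Nat.zero_le _
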